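/- \textbf{Proposition.} Let $K$ denote prefix-free Kolmogorov complexity with respect to an arbitrary optimal (universal) prefix-free machine, and for $n\in\mathbb N$ let $K(n)$ be the complexity of the binary string $x$ such that $1x$ is the binary expansion of $n+1$. Let $\mu$ be a (Borel) probability measure on Cantor space $\{0,1\}^{\mathbb N}$, and for $n \in \mathbb N$ let $$K(\mu\upharpoonright n)=\sum_{|x|=n}K(x)\,\mu[x]$$ be the $\mu$-average of $K$ over all binary strings $x$ of length $n$, where $[x]$ is the set of infinite bit sequences extending $x$. Suppose that there is $r\in\mathbb R$ such that $$K(\mu\upharpoonright n)\ \ge\ n+K(n)-r\qquad\text{for infinitely many } n .$$ Then $\mu$ is Martin-Löf absolutely continuous, that is, $\inf_m\mu(G_m)=0$ for every Martin-Löf test $(G_m)_{m\in\mathbb N}$. Here a Martin-Löf test is a sequence of uniformly effectively open (uniformly $\Sigma^0_1$) subsets of $\{0,1\}^{\mathbb N}$ such that $\lambda(G_m)\le 2^{-m}$ for each $m$, where $\lambda$ is the uniform (fair coin) measure. -/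

import Mathlib

open MeasureTheory

/-! ### Prefix-free machines and prefix-free Kolmogorov complexity -/

/-- A prefix-free machine: a partial computable function from binary strings to binary strings
whose domain is prefix-free. -/
def IsPrefixFreeMachine (M : List Bool →. List Bool) : Prop :=
  Partrec M ∧ ∀ σ τ : List Bool, (M σ).Dom → (M τ).Dom → σ <+: τ → σ = τ

/-- An optimal (universal) prefix-free machine: it simulates every prefix-free machine, up to a
constant increase (depending on the machine) of the length of descriptions. -/
def IsOptimalPrefixFreeMachine (U : List Bool →. List Bool) : Prop :=
  IsPrefixFreeMachine U ∧ ∀ M : List Bool →. List Bool, IsPrefixFreeMachine M →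
    ∃ c : ℕ, ∀ σ x : List Bool, x ∈ M σ → ∃ τ : List Bool, x ∈ U τ ∧ τ.length ≤ σ.length + c

/-- Prefix-free complexity `K(x)` with respect to the machine `U`: the length of a shortest
`U`-description of `x`. (If `U` is optimal then every string has a `U`-description.) -/
noncomputable def prefixK (U : List Bool →. List Bool) (x : List Bool) : ℕ :=
  sInf {l : ℕ | ∃ σ : List Bool, x ∈ U σ ∧ σ.length = l}

/-- The usual bijection from natural numbers to binary strings: `n` is sent to the string `x` such
that `1x` is the binary expansion of `n + 1` (`0 ↦ λ, 1 ↦ 0, 2 ↦ 1, 3 ↦ 00, …`).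
(`Nat.bits` lists the binary digits with the least significant one first.) -/
def natToString (n : ℕ) : List Bool := (n + 1).bits.dropLast.reverse

/-- `K(n)` for a natural number `n`. -/
noncomputable def prefixKNat (U : List Bool →. List Bool) (n : ℕ) : ℕ := prefixK U (natToString n)

/-! ### Measures on Cantor space -/

/-- The basic open cylinder `[σ]` of all infinite bit sequences that extend the string `σ`. -/
def stringCylinder (σ : List Bool) : Set (ℕ → Bool) := {Z | ∀ (i : ℕ) (h : i < σ.length), Z i = σ[i]}

/-- The uniform measure on Cantor space: the law of a sequence of independent fair coin tosses. -/
noncomputable def uniformMeasure : Measure (ℕ → Bool) :=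
  Measure.infinitePi fun _ : ℕ => (PMF.uniformOfFintype Bool).toMeasure

/-- `K(μ ↾ n)`: the `μ`-average `∑_{|x| = n} K(x) μ[x]` of the complexities `K(x)` of all strings
`x` of length `n`. -/
noncomputable def averageK (U : List Bool →. List Bool) (μ : Measure (ℕ → Bool)) (n : ℕ) : ℝ :=
  ∑ x : Fin n → Bool, (prefixK U (List.ofFn x) : ℝ) * μ.real (stringCylinder (List.ofFn x))

/-- A Martin-Löf test: a uniformly effectively open sequence `(G m)` (that is, `G m` is the union
of the cylinders given by the `m`-th section of a recursively enumerable set of pairs), with the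
uniform measure of `G m` at most `2 ^ (-m)`. -/
def IsMLTest (G : ℕ → Set (ℕ → Bool)) : Prop :=
  (∃ W : ℕ × List Bool → Prop, REPred W ∧ ∀ m, G m = ⋃ σ ∈ {σ | W (m, σ)}, stringCylinder σ) ∧
    ∀ m, uniformMeasure (G m) ≤ (2 ^ m : ENNReal)⁻¹

/-- Martin-Löf absolute continuity of a measure on Cantor space. -/
def IsMLAbsolutelyContinuous (μ : Measure (ℕ → Bool)) : Prop :=
  ∀ G : ℕ → Set (ℕ → Bool), IsMLTest G → ⨅ m, μ (G m) = 0

/-! ### Optimal prefix-free machines exist -/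

namespace OptimalMachine

open Encodable
open Nat.Partrec (Code)

/-- The computation of the program `c` that is coded by `p` (step bound and input). -/
def run (c : Code) (p : ℕ) : Option ℕ := Code.evaln p.unpair.1 c p.unpair.2

/-- `a` is a prefix of `b`, as an equation. -/
def Pre (a b : List Bool) : Prop := b.take a.length = a

/-- The computation coded by `p` halts on an input comparable with, but different from, `τ`. -/
def Conflict (p : ℕ) (q : Code × List Bool) : Prop :=
  ∃ τ' ∈ (decode (α := List Bool) p.unpair.2).toList,
    (Pre τ' q.2 ∨ Pre q.2 τ') ∧ ¬ τ' = q.2 ∧ ¬ run q.1 p = none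

theorem pre_iff (a b : List Bool) : Pre a b ↔ a <+: b := by
  rw [List.prefix_iff_eq_take, Pre, eq_comm]

theorem primrec_run : Primrec₂ run :=
  Code.primrec_evaln.comp <| ((Primrec.fst.comp (Primrec.unpair.comp Primrec.snd)).pair
    Primrec.fst).pair (Primrec.snd.comp (Primrec.unpair.comp Primrec.snd))

theorem primrec_pre : PrimrecRel Pre :=
  Primrec.eq.comp (Primrec.list_take.comp (Primrec.list_length.comp Primrec.fst) Primrec.snd)
    Primrec.fst

theorem primrec_conflict : PrimrecRel Conflict := by
  have h : PrimrecRel fun (τ' : List Bool) (b : ℕ × (Code × List Bool)) =>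
      (Pre τ' b.2.2 ∨ Pre b.2.2 τ') ∧ ¬ τ' = b.2.2 ∧ ¬ run b.2.1 b.1 = none := by
    have h2 : Primrec fun x : List Bool × (ℕ × (Code × List Bool)) => x.2.2.2 :=
      Primrec.snd.comp (Primrec.snd.comp Primrec.snd)
    have hr : Primrec fun x : List Bool × (ℕ × (Code × List Bool)) => run x.2.2.1 x.2.1 :=
      primrec_run.comp (Primrec.fst.comp (Primrec.snd.comp Primrec.snd))
        (Primrec.fst.comp Primrec.snd)
    exact ((primrec_pre.comp Primrec.fst h2).or (primrec_pre.comp h2 Primrec.fst)).and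
      ((Primrec.eq.comp Primrec.fst h2).not.and (Primrec.eq.comp hr (Primrec.const none)).not)
  have hl : Primrec fun x : ℕ × (Code × List Bool) =>
      (decode (α := List Bool) x.1.unpair.2).toList := by
    have := Primrec.decode (α := List Bool) |>.comp
      (Primrec.snd.comp (Primrec.unpair.comp (Primrec.fst (α := ℕ) (β := Code × List Bool))))
    refine (Primrec.option_casesOn this (Primrec.const [])
      (Primrec.list_cons.comp Primrec.snd (Primrec.const [])).to₂).of_eq fun x => ?_
    cases decode (α := List Bool) x.1.unpair.2 <;> rfl
  exact h.exists_mem_list.comp hl Primrec.id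

open Classical in
/-- One step of the search of the machine: `σ = 0^e 1 τ` is accepted at `p` if `p` codes a halting
computation of the `e`-th program on input `τ` and no earlier computation is in conflict. -/
noncomputable def step (σ : List Bool) (p : ℕ) : Option (List Bool) :=
  let e := σ.findIdx id
  let τ := σ.drop (e + 1)
  if p.unpair.2 = encode τ ∧ e < σ.length ∧
      ∀ p' < p, ¬ Conflict p' (Denumerable.ofNat Code e, τ) then
    (run (Denumerable.ofNat Code e) p).bind decode
  else none

theorem primrec_step : Primrec₂ step := by
  classical
  have he : Primrec fun x : List Bool × ℕ => x.1.findIdx id :=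
    Primrec.list_findIdx Primrec.fst (Primrec.id.comp Primrec.snd).to₂
  have ht : Primrec fun x : List Bool × ℕ => x.1.drop (x.1.findIdx id + 1) :=
    Primrec.list_drop.comp (Primrec.succ.comp he) Primrec.fst
  have hc : Primrec fun x : List Bool × ℕ => Denumerable.ofNat Code (x.1.findIdx id) :=
    (Primrec.ofNat Code).comp he
  have hN : PrimrecRel fun (p' : ℕ) (q : Code × List Bool) => ¬ Conflict p' q := by
    exact PrimrecPred.not primrec_conflict
  have hF : PrimrecRel fun (n : ℕ) (q : Code × List Bool) => ∀ p' < n, ¬ Conflict p' q :=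
    (hN.forall_mem_list.comp (Primrec.list_range.comp Primrec.fst) Primrec.snd).of_eq
      fun x => by simp
  have hA : PrimrecPred fun x : List Bool × ℕ => ∀ p' < x.2,
      ¬ Conflict p' (Denumerable.ofNat Code (x.1.findIdx id), x.1.drop (x.1.findIdx id + 1)) :=
    hF.comp Primrec.snd (hc.pair ht)
  refine Primrec.ite (PrimrecPred.and (Primrec.eq.comp
      (Primrec.snd.comp (Primrec.unpair.comp Primrec.snd)) (Primrec.encode.comp ht))
    (PrimrecPred.and (Primrec.nat_lt.comp he (Primrec.list_length.comp Primrec.fst)) hA)) ?_ (Primrec.const none)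
  exact Primrec.option_bind (primrec_run.comp hc Primrec.snd) (Primrec.decode.comp Primrec.snd).to₂

/-- The machine. -/
noncomputable def machine (σ : List Bool) : Part (List Bool) := Nat.rfindOpt (step σ)

theorem mem_step {σ : List Bool} {p : ℕ} {x : List Bool} (h : x ∈ step σ p) :
    ∃ e τ, σ = List.replicate e false ++ true :: τ ∧ p.unpair.2 = encode τ ∧
      (∀ p' < p, ¬ Conflict p' (Denumerable.ofNat Code e, τ)) ∧
      x ∈ (run (Denumerable.ofNat Code e) p).bind decode := by
  unfold step at h
  simp only at h
  split_ifs at h with hc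
  · obtain ⟨h1, h2, h3⟩ := hc
    refine ⟨σ.findIdx id, σ.drop (σ.findIdx id + 1), ?_, h1, h3, h⟩
    conv_lhs => rw [← List.take_append_drop (σ.findIdx id) σ]
    congr 1
    · refine List.ext_getElem (by simp [h2.le]) fun i hi hi' => ?_
      have : i < σ.findIdx id := by simpa using hi'
      simpa using List.not_of_lt_findIdx this
    · rw [List.drop_eq_getElem_cons h2]
      congr 1
      simpa using List.findIdx_getElem (w := h2)
  · simp at h

theorem step_eq (e : ℕ) (τ : List Bool) (p : ℕ) (h1 : p.unpair.2 = encode τ)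
    (h2 : ∀ p' < p, ¬ Conflict p' (Denumerable.ofNat Code e, τ)) :
    step (List.replicate e false ++ true :: τ) p =
      (run (Denumerable.ofNat Code e) p).bind decode := by
  have hf : (List.replicate e false ++ true :: τ).findIdx id = e := by
    clear h2
    induction e with
    | zero => simp [List.findIdx_cons]
    | succ n ih => simp [List.replicate_succ, List.findIdx_cons, ih]
  have hd : (List.replicate e false ++ true :: τ).drop (e + 1) = τ := by
    rw [List.drop_append]; simp
  have hl : e < (List.replicate e false ++ true :: τ).length := by simp
  unfold step
  generalize List.replicate e false ++ true :: τ = σ at hf hd hl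
  subst hf hd
  exact if_pos ⟨h1, hl, h2⟩

theorem split_prefix {e e' : ℕ} {τ τ' : List Bool}
    (h : (List.replicate e false ++ true :: τ) <+: (List.replicate e' false ++ true :: τ')) :
    e = e' ∧ τ <+: τ' := by
  induction e generalizing e' with
  | zero =>
    cases e' with
    | zero => simpa using h
    | succ n => simp [List.replicate_succ] at h
  | succ m ih =>
    cases e' with
    | zero => simp [List.replicate_succ] at h
    | succ n =>
      simp only [List.replicate_succ, List.cons_append, List.cons_prefix_cons, true_and] at h
      obtain ⟨rfl, h'⟩ := ih h
      exact ⟨rfl, h'⟩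

theorem isPrefixFreeMachine : IsPrefixFreeMachine machine := by
  refine ⟨Partrec.rfindOpt primrec_step.to_comp, fun σ σ' h h' hp => ?_⟩
  obtain ⟨p, x, hx⟩ := Nat.rfindOpt_dom.1 h
  obtain ⟨p', x', hx'⟩ := Nat.rfindOpt_dom.1 h'
  obtain ⟨e, τ, rfl, h1, h2, h3⟩ := mem_step hx
  obtain ⟨e', τ', rfl, h1', h2', h3'⟩ := mem_step hx'
  obtain ⟨rfl, hpre⟩ := split_prefix hp
  have r1 : run (Denumerable.ofNat Code e) p ≠ none := fun h0 => by simp [h0] at h3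
  have r2 : run (Denumerable.ofNat Code e) p' ≠ none := fun h0 => by simp [h0] at h3'
  by_contra hne
  have hne' : τ ≠ τ' := fun h0 => hne (by rw [h0])
  rcases lt_trichotomy p p' with hlt | rfl | hlt
  · exact h2' p hlt ⟨τ, by simp [h1], Or.inl ((pre_iff _ _).2 hpre), hne', r1⟩
  · exact hne' (encode_injective (h1.symm.trans h1'))
  · exact h2 p' hlt ⟨τ', by simp [h1'], Or.inr ((pre_iff _ _).2 hpre), hne'.symm, r2⟩

theorem isOptimal : IsOptimalPrefixFreeMachine machine := by
  refine ⟨isPrefixFreeMachine, fun M ⟨hM, hpf⟩ => ?_⟩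
  obtain ⟨c, hc⟩ := Code.exists_code.1 hM
  have hrun : ∀ (τ : List Bool) (p n : ℕ), decode (α := List Bool) p.unpair.2 = some τ →
      n ∈ run c p → ∃ y ∈ M τ, encode y = n := by
    intro τ p n hτ hn
    have := Code.evaln_sound hn
    rw [hc] at this
    simpa [hτ] using this
  refine ⟨encode c + 1, fun σ x hx => ⟨List.replicate (encode c) false ++ true :: σ, ?_, ?_⟩⟩
  · have hval : encode x ∈ c.eval (encode σ) := by
      rw [hc]; simpa using hx
    obtain ⟨s, hs⟩ := Code.evaln_complete.1 hval
    have hstep : x ∈ step (List.replicate (encode c) false ++ true :: σ)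
        (Nat.pair s (encode σ)) := by
      rw [step_eq]
      · have : run c (Nat.pair s (encode σ)) = some (encode x) := by simpa [run] using hs
        simp [this]
      · simp
      · rintro p' - ⟨τ', hτ', hcmp, hne, hr⟩
        simp only [Denumerable.ofNat_encode] at hr hcmp hne
        obtain ⟨n, hn⟩ := Option.ne_none_iff_exists'.1 hr
        obtain ⟨y, hy, -⟩ := hrun τ' p' n (by simpa using hτ') hn
        rcases hcmp with h | h
        · exact hne (hpf _ _ (Part.dom_iff_mem.2 ⟨y, hy⟩) (Part.dom_iff_mem.2 ⟨x, hx⟩)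
            ((pre_iff _ _).1 h))
        · exact hne (hpf _ _ (Part.dom_iff_mem.2 ⟨x, hx⟩) (Part.dom_iff_mem.2 ⟨y, hy⟩)
            ((pre_iff _ _).1 h)).symm
    have hdom : (machine (List.replicate (encode c) false ++ true :: σ)).Dom :=
      Nat.rfindOpt_dom.2 ⟨_, x, hstep⟩
    obtain ⟨x', hx'⟩ := Part.dom_iff_mem.1 hdom
    obtain ⟨p, hp⟩ := Nat.rfindOpt_spec hx'
    obtain ⟨e, τ, heq, h1, -, h3⟩ := mem_step hp
    obtain ⟨rfl, hpre⟩ := split_prefix ⟨[], (List.append_nil _).trans heq⟩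
    have hτ : τ = σ := by simpa using heq.symm
    subst hτ
    simp only [Denumerable.ofNat_encode] at h3
    obtain ⟨n, hn, hn'⟩ := Option.bind_eq_some_iff.1 h3
    obtain ⟨y, hy, rfl⟩ := hrun τ p n (by simp [h1]) hn
    have : x' = x := by
      have h5 : y = x' := by simpa using hn'
      exact h5 ▸ Part.mem_unique hy hx
    exact this ▸ hx'
  · simp; omega

end OptimalMachine

/-- An optimal prefix-free machine exists. -/
theorem exists_isOptimalPrefixFreeMachine : ∃ U, IsOptimalPrefixFreeMachine U :=
  ⟨_, OptimalMachine.isOptimal⟩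

/-! ### Recursive approximations -/

/-! A Martin-Löf test compresses the strings that fall into it, and too much compression on a set of
positive measure pulls the average below `n + K(n) - r`. Since `λ(G_{2k}) ≤ 2^{-2k}`, at most
`2^{n-2k}` strings of length `n` have a prefix enumerated into section `2k`. Such a string is
described by `0^k 1 ρ τ`, where `ρ` is a shortest description of `n` and `τ`, of length `n - 2k`, is
the index of the string in the enumeration. The description is self-delimiting, and the header costs
`k + 1` bits while the index saves `2k`. So `K(x) ≤ n + K(n) - k + c` with `c` independent of `k`
and `n` (`exists_prefixK_add_le`, with the count from `card_mul_two_pow_le`). For `k = 0`, with all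
strings in place of the section, this is the usual bound `K(x) ≤ n + K(n) + c`. Let `D_n` be the set
of sequences whose first `n` bits have a prefix in section `2k`. Averaging gives `K(μ↾n) + k μ(D_n)
≤ n + K(n) + c` (`averageK_add_le`). The sets `D_n` increase to `G_{2k}`. If `μ(G_m) > δ > 0` for
all `m`, then `k` with `kδ > r + c` contradicts the hypothesis at every large `n` where it holds. -/

open Encodable in
theorem Partrec.exists_primrec_approx {α β : Type*} [Primcodable α] [Primcodable β] {f : α →. β}
    (hf : Partrec f) :
    ∃ u : α → ℕ → Option β, Primrec₂ u ∧ ∀ a x, x ∈ f a ↔ ∃ s, u a s = some x := by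
  obtain ⟨c, hc⟩ := Nat.Partrec.Code.exists_code.1 hf
  refine ⟨fun a s => (Nat.Partrec.Code.evaln s c (encode a)).bind decode, ?_, fun a x => ?_⟩
  · refine Primrec.option_bind ?_ (Primrec.decode.comp Primrec.snd).to₂
    exact Nat.Partrec.Code.primrec_evaln.comp
      ((Primrec.snd.pair (Primrec.const c)).pair (Primrec.encode.comp Primrec.fst))
  · have key : ∀ n, n ∈ c.eval (encode a) ↔ ∃ y ∈ f a, encode y = n := by
      intro n
      rw [hc]
      simp
    constructor
    · intro hx
      obtain ⟨s, hs⟩ := Nat.Partrec.Code.evaln_complete.1 ((key _).2 ⟨x, hx, rfl⟩)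
      exact ⟨s, by simp [Option.mem_def.1 hs]⟩
    · rintro ⟨s, hs⟩
      obtain ⟨n, hn, hn'⟩ := Option.bind_eq_some_iff.1 hs
      obtain ⟨y, hy, rfl⟩ := (key n).1 (Nat.Partrec.Code.evaln_sound hn)
      have : y = x := by simpa using hn'
      exact this ▸ hy

theorem REPred.exists_primrec_approx {α : Type*} [Primcodable α] {p : α → Prop} (hp : REPred p) :
    ∃ w : α → ℕ → Option Unit, Primrec₂ w ∧ ∀ a, p a ↔ ∃ s, w a s = some () := by
  obtain ⟨w, hw, h⟩ := Partrec.exists_primrec_approx hp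
  exact ⟨w, hw, fun a => by rw [← h]; simp⟩

/-! ### Enumeration without repetition -/

section collect

variable {β : Type*} [DecidableEq β]

/-- The distinct values of the first `T` terms of `h`, in the order of their first occurrence. -/
def collect (h : ℕ → Option β) (T : ℕ) : List β :=
  Nat.rec [] (fun t L => ((h t).map fun x => if x ∈ L then L else L ++ [x]).getD L) T

theorem collect_succ (h : ℕ → Option β) (T : ℕ) : collect h (T + 1) =
    ((h T).map fun x => if x ∈ collect h T then collect h T else collect h T ++ [x]).getD
      (collect h T) := rfl

/-- Without repetitions, the length of the list, and so every index into it, is bounded by the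
number of strings enumerated. -/
theorem nodup_collect (h : ℕ → Option β) (T : ℕ) : (collect h T).Nodup := by
  induction T with
  | zero => exact List.nodup_nil
  | succ T ih =>
    rw [collect_succ]
    cases h T with
    | none => simpa using ih
    | some x =>
      by_cases hx : x ∈ collect h T
      · simpa [hx] using ih
      · simpa [hx, List.nodup_append, ih] using fun a ha (hax : a = x) => hx (hax ▸ ha)

theorem collect_prefix_succ (h : ℕ → Option β) (T : ℕ) : collect h T <+: collect h (T + 1) := by
  rw [collect_succ]
  cases h T with
  | none => simp
  | some x => by_cases hx : x ∈ collect h T <;> simp [hx]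

theorem collect_prefix (h : ℕ → Option β) {S T : ℕ} (hST : S ≤ T) :
    collect h S <+: collect h T := by
  induction hST with
  | refl => exact List.prefix_rfl
  | step _ ih => exact ih.trans (collect_prefix_succ h _)

theorem mem_collect {h : ℕ → Option β} {T : ℕ} {x : β} :
    x ∈ collect h T ↔ ∃ t < T, h t = some x := by
  induction T with
  | zero => simp [collect]
  | succ T ih =>
    simp only [Nat.lt_succ_iff_lt_or_eq, or_and_right, exists_or, exists_eq_left, ← ih]
    rw [collect_succ]
    cases h T with
    | none => simp
    | some y =>
      by_cases hy : y ∈ collect h T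
      · simp only [hy, Option.map_some, if_true, Option.getD_some, Option.some.injEq]
        exact ⟨Or.inl, fun H => H.elim id fun H => H ▸ hy⟩
      · simp [hy, eq_comm]

/-- Later lists extend earlier ones, so an index, once filled, names the same element at every
stage. -/
theorem collect_getElem?_unique {h : ℕ → Option β} {S T i : ℕ} {x y : β}
    (hx : (collect h S)[i]? = some x) (hy : (collect h T)[i]? = some y) : x = y := by
  rcases le_total S T with H | H
  · obtain ⟨L, hL⟩ := collect_prefix h H
    rw [← hL, List.getElem?_append_left (List.getElem?_eq_some_iff.1 hx).1, hx] at hy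
    exact Option.some.inj hy
  · obtain ⟨L, hL⟩ := collect_prefix h H
    rw [← hL, List.getElem?_append_left (List.getElem?_eq_some_iff.1 hy).1, hy] at hx
    exact (Option.some.inj hx).symm

end collect

theorem primrec_collect {α β : Type*} [Primcodable α] [Primcodable β] [DecidableEq β]
    {h : α → ℕ → Option β} (hh : Primrec₂ h) : Primrec₂ fun a T => collect (h a) T := by
  have hm : PrimrecRel fun (L : List β) (x : β) => x ∈ L :=
    ((Primrec.eq (α := β)).exists_mem_list).of_eq fun p => by simp
  have hL : Primrec fun p : (α × ℕ × List β) × β => p.1.2.2 :=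
    Primrec.snd.comp (Primrec.snd.comp Primrec.fst)
  have hstep : Primrec₂ fun (p : α × ℕ × List β) (x : β) =>
      if x ∈ p.2.2 then p.2.2 else p.2.2 ++ [x] :=
    Primrec.ite (hm.comp hL Primrec.snd) hL (Primrec.list_concat.comp hL Primrec.snd)
  have hg : Primrec₂ fun (a : α) (p : ℕ × List β) =>
      ((h a p.1).map fun x => if x ∈ p.2 then p.2 else p.2 ++ [x]).getD p.2 :=
    Primrec.option_getD.comp (Primrec.option_map
      (hh.comp Primrec.fst (Primrec.fst.comp Primrec.snd)) hstep) (Primrec.snd.comp Primrec.snd)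
  exact Primrec.nat_rec (f := fun _ : α => ([] : List β)) (Primrec.const []) hg

/-! ### Binary values of strings -/

/-- The number whose binary expansion is that of `a` followed by the string `l`. -/
def binVal (a : ℕ) (l : List Bool) : ℕ := l.foldl (fun a b => 2 * a + cond b 1 0) a

theorem binVal_concat (a : ℕ) (l : List Bool) (b : Bool) :
    binVal a (l ++ [b]) = 2 * binVal a l + cond b 1 0 := by
  simp [binVal]

theorem primrec_binVal (a : ℕ) : Primrec (binVal a) := by
  have h : Primrec₂ fun (_ : List Bool) (p : ℕ × Bool) => 2 * p.1 + cond p.2 1 0 :=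
    Primrec.nat_add.comp
      (Primrec.nat_mul.comp (Primrec.const 2) (Primrec.fst.comp Primrec.snd))
      (Primrec.cond (Primrec.snd.comp Primrec.snd) (Primrec.const 1) (Primrec.const 0))
  exact Primrec.list_foldl Primrec.id (Primrec.const a) h

theorem exists_binVal_zero_eq (l : ℕ) : ∀ i < 2 ^ l, ∃ τ : List Bool, τ.length = l ∧ binVal 0 τ = i := by
  induction l with
  | zero => exact fun i hi => ⟨[], rfl, by simp at hi; simp [binVal, hi]⟩
  | succ l ih =>
    intro i hi
    obtain ⟨τ, h1, h2⟩ := ih (i / 2) (by rw [pow_succ] at hi; omega)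
    refine ⟨τ ++ [decide (i % 2 = 1)], by simp [h1], ?_⟩
    rw [binVal_concat, h2]
    rcases Nat.mod_two_eq_zero_or_one i with h | h <;> simp [h] <;> omega

theorem binVal_one_bits {m : ℕ} (hm : m ≠ 0) : binVal 1 m.bits.dropLast.reverse = m := by
  induction m using Nat.binaryRec' with
  | zero => exact absurd rfl hm
  | bit b k hb ih =>
    rw [Nat.bits_append_bit k b hb]
    rcases eq_or_ne k 0 with rfl | hk
    · simp [hb rfl, binVal]
    · have hne : k.bits ≠ [] := by
        -- If `k` had no digits, the induction hypothesis would read `k = binVal 1 [] = 1`, which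
        -- does have one.
        intro h0
        have := ih hk
        rw [h0] at this
        subst this
        simp [binVal] at h0
      rw [List.dropLast_cons_of_ne_nil hne, List.reverse_cons, binVal_concat, ih hk]
      cases b <;> simp [Nat.bit]

/-- The starting value `1` restores the leading digit that `natToString` drops. This is the source
of the `+ 1` in the length test of `blockStep`. -/
theorem binVal_natToString (n : ℕ) : binVal 1 (natToString n) = n + 1 :=
  binVal_one_bits n.succ_ne_zero

/-! ### A prefix-free machine for blocks of enumerated strings -/

open Encodable in
/-- The `t`-th candidate for a string of length `q.2` with a prefix in the `q.1`-th section of the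
set approximated by `w`; the section `0` is replaced by the set of all strings. -/
def candidate (w : ℕ × List Bool → ℕ → Option Unit) (q : ℕ × ℕ) (t : ℕ) : Option (List Bool) :=
  (decode (α := List Bool) t.unpair.2).bind fun x =>
    if x.length = q.2 ∧ (q.1 = 0 ∨
      w (q.1, x.take t.unpair.1.unpair.2) t.unpair.1.unpair.1 = some ()) then some x else none

theorem primrec_candidate {w : ℕ × List Bool → ℕ → Option Unit} (hw : Primrec₂ w) :
    Primrec₂ (candidate w) := by
  have ht : Primrec fun p : ((ℕ × ℕ) × ℕ) × List Bool => p.1.2.unpair.1.unpair :=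
    Primrec.unpair.comp (Primrec.fst.comp (Primrec.unpair.comp (Primrec.snd.comp Primrec.fst)))
  have hq1 : Primrec fun p : ((ℕ × ℕ) × ℕ) × List Bool => p.1.1.1 :=
    Primrec.fst.comp (Primrec.fst.comp Primrec.fst)
  have hq2 : Primrec fun p : ((ℕ × ℕ) × ℕ) × List Bool => p.1.1.2 :=
    Primrec.snd.comp (Primrec.fst.comp Primrec.fst)
  refine Primrec.option_bind
    (Primrec.decode.comp (Primrec.snd.comp (Primrec.unpair.comp Primrec.snd))) ?_
  refine Primrec.ite (PrimrecPred.and (Primrec.eq.comp (Primrec.list_length.comp Primrec.snd) hq2)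
    (PrimrecPred.or (Primrec.eq.comp hq1 (Primrec.const 0)) (Primrec.eq.comp ?_
      (Primrec.const (some ()))))) (Primrec.option_some.comp Primrec.snd) (Primrec.const none)
  exact hw.comp (hq1.pair (Primrec.list_take.comp (Primrec.snd.comp ht) Primrec.snd))
    (Primrec.fst.comp ht)

/-- The index `t` codes a stage `s`, a prefix length `j` and a string `x`, so running through all
`t` tries every such triple. -/
theorem exists_candidate_eq_some {w : ℕ × List Bool → ℕ → Option Unit} {q : ℕ × ℕ}
    {x : List Bool} : (∃ t, candidate w q t = some x) ↔
      x.length = q.2 ∧ (q.1 = 0 ∨ ∃ j s, w (q.1, x.take j) s = some ()) := by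
  constructor
  · rintro ⟨t, ht⟩
    obtain ⟨y, -, hy⟩ := Option.bind_eq_some_iff.1 ht
    split_ifs at hy with hc
    obtain rfl := Option.some.inj hy
    exact ⟨hc.1, hc.2.imp_right fun h => ⟨_, _, h⟩⟩
  · rintro ⟨h1, h2 | ⟨j, s, h⟩⟩
    · exact ⟨Nat.pair 0 (Encodable.encode x), by simp [candidate, h1, h2]⟩
    · exact ⟨Nat.pair (Nat.pair s j) (Encodable.encode x), by simp [candidate, h1, h]⟩

theorem findIdx_replicate_append (e : ℕ) (β : List Bool) :
    (List.replicate e false ++ true :: β).findIdx id = e := by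
  induction e with
  | zero => simp [List.findIdx_cons]
  | succ n ih => simp [List.replicate_succ, List.findIdx_cons, ih]

theorem eq_replicate_append_of_findIdx_lt {α : List Bool} (h : α.findIdx id < α.length) :
    α = List.replicate (α.findIdx id) false ++ true :: α.drop (α.findIdx id + 1) := by
  conv_lhs => rw [← List.take_append_drop (α.findIdx id) α]
  congr 1
  · refine List.ext_getElem (by simp [h.le]) fun i hi hi' => ?_
    have : i < α.findIdx id := by simpa using hi'
    simpa using List.not_of_lt_findIdx this
  · rw [List.drop_eq_getElem_cons h]
    congr 1
    simpa using List.findIdx_getElem (w := h)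

/-- One step of the computation of `blockMachine`. The input `α = 0^e 1 ρ τ` is split with
`|ρ| = p.unpair.1`. -/
def blockStep (u : List Bool → ℕ → Option (List Bool)) (w : ℕ × List Bool → ℕ → Option Unit)
    (α : List Bool) (p : ℕ) : Option (List Bool) :=
  (u ((α.drop (α.findIdx id + 1)).take p.unpair.1) p.unpair.2.unpair.1).bind fun v =>
    if α.findIdx id < α.length ∧
      ((α.drop (α.findIdx id + 1)).drop p.unpair.1).length + 2 * α.findIdx id + 1 = binVal 1 v then
      (collect (candidate w (2 * α.findIdx id,
        ((α.drop (α.findIdx id + 1)).drop p.unpair.1).length + 2 * α.findIdx id))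
          p.unpair.2.unpair.2)[binVal 0 ((α.drop (α.findIdx id + 1)).drop p.unpair.1)]?
    else none

theorem primrec_blockStep {u : List Bool → ℕ → Option (List Bool)} (hu : Primrec₂ u)
    {w : ℕ × List Bool → ℕ → Option Unit} (hw : Primrec₂ w) : Primrec₂ (blockStep u w) := by
  have he : Primrec fun x : List Bool × ℕ => x.1.findIdx id :=
    Primrec.list_findIdx Primrec.fst (Primrec.id.comp Primrec.snd).to₂
  have hβ : Primrec fun x : List Bool × ℕ => x.1.drop (x.1.findIdx id + 1) :=
    Primrec.list_drop.comp (Primrec.succ.comp he) Primrec.fst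
  have hl : Primrec fun x : List Bool × ℕ => x.2.unpair.1 :=
    Primrec.fst.comp (Primrec.unpair.comp Primrec.snd)
  have hs : Primrec fun x : List Bool × ℕ => x.2.unpair.2.unpair :=
    Primrec.unpair.comp (Primrec.snd.comp (Primrec.unpair.comp Primrec.snd))
  have hτ : Primrec fun x : List Bool × ℕ =>
      (x.1.drop (x.1.findIdx id + 1)).drop x.2.unpair.1 := Primrec.list_drop.comp hl hβ
  have hm : Primrec fun x : List Bool × ℕ => 2 * x.1.findIdx id :=
    Primrec.nat_mul.comp (Primrec.const 2) he
  have hn : Primrec fun x : List Bool × ℕ =>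
      ((x.1.drop (x.1.findIdx id + 1)).drop x.2.unpair.1).length + 2 * x.1.findIdx id :=
    Primrec.nat_add.comp (Primrec.list_length.comp hτ) hm
  have hc : Primrec fun x : List Bool × ℕ =>
      (collect (candidate w (2 * x.1.findIdx id,
        ((x.1.drop (x.1.findIdx id + 1)).drop x.2.unpair.1).length + 2 * x.1.findIdx id))
          x.2.unpair.2.unpair.2)[binVal 0 ((x.1.drop (x.1.findIdx id + 1)).drop x.2.unpair.1)]? :=
    Primrec.list_getElem?.comp
      ((primrec_collect (primrec_candidate hw)).comp (hm.pair hn) (Primrec.snd.comp hs))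
      ((primrec_binVal 0).comp hτ)
  refine Primrec.option_bind (hu.comp (Primrec.list_take.comp hl hβ) (Primrec.fst.comp hs)) ?_
  exact Primrec.ite (PrimrecPred.and
    (Primrec.nat_lt.comp (he.comp Primrec.fst) (Primrec.list_length.comp
      (Primrec.fst.comp Primrec.fst)))
    (Primrec.eq.comp (Primrec.succ.comp (hn.comp Primrec.fst))
      ((primrec_binVal 1).comp Primrec.snd))) (hc.comp Primrec.fst) (Primrec.const none)

/-- The number `p` codes a guess for `|ρ|` and two stages: `s` for `u` and `T` for the enumeration.
The search thus ranges over all ways to split the input. -/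
theorem exists_blockStep_eq_some {u : List Bool → ℕ → Option (List Bool)}
    {w : ℕ × List Bool → ℕ → Option Unit} {α x : List Bool} :
    (∃ p, blockStep u w α p = some x) ↔ ∃ e ρ τ v s T,
      α = List.replicate e false ++ true :: (ρ ++ τ) ∧ u ρ s = some v ∧
      τ.length + 2 * e + 1 = binVal 1 v ∧
      (collect (candidate w (2 * e, τ.length + 2 * e)) T)[binVal 0 τ]? = some x := by
  constructor
  · rintro ⟨p, hp⟩
    obtain ⟨v, hv, hx⟩ := Option.bind_eq_some_iff.1 hp
    split_ifs at hx with hc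
    refine ⟨_, _, _, v, _, _, ?_, hv, hc.2, hx⟩
    rw [List.take_append_drop]
    exact eq_replicate_append_of_findIdx_lt hc.1
  · rintro ⟨e, ρ, τ, v, s, T, rfl, hv, hn, hx⟩
    refine ⟨Nat.pair ρ.length (Nat.pair s T), ?_⟩
    have hd : (List.replicate e false ++ true :: (ρ ++ τ)).drop (e + 1) = ρ ++ τ := by
      rw [List.drop_append]; simp
    simp only [blockStep, findIdx_replicate_append, hd, Nat.unpair_pair, List.take_left',
      List.drop_left', hv, Option.bind_some]
    rw [if_pos ⟨by simp, hn⟩, hx]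

/-- The machine that maps `0^e 1 ρ τ`, where `u` approximates a description `ρ` of
`n = |τ| + 2 e`, to the string of length `n` whose index in the enumeration is given by `τ`. -/
def blockMachine (u : List Bool → ℕ → Option (List Bool)) (w : ℕ × List Bool → ℕ → Option Unit)
    (α : List Bool) : Part (List Bool) := Nat.rfindOpt (blockStep u w α)

section blockMachine

variable {U : List Bool →. List Bool} {u : List Bool → ℕ → Option (List Bool)}
  {w : ℕ × List Bool → ℕ → Option Unit}

/-- The header `0^e 1` delimits itself. Then `ρ` and `ρ'` are comparable elements of the prefix-free
domain of `U`, hence equal; their common output fixes the length of `τ`. This yields both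
prefix-freeness and single-valuedness of `blockMachine`. -/
theorem parse_unique (hpf : ∀ σ τ : List Bool, (U σ).Dom → (U τ).Dom → σ <+: τ → σ = τ)
    (hu : ∀ σ x, x ∈ U σ ↔ ∃ s, u σ s = some x) {e e' : ℕ} {ρ ρ' τ τ' v v' : List Bool} {s s' : ℕ}
    (h : List.replicate e false ++ true :: (ρ ++ τ) <+:
      List.replicate e' false ++ true :: (ρ' ++ τ'))
    (hv : u ρ s = some v) (hv' : u ρ' s' = some v')
    (hn : τ.length + 2 * e + 1 = binVal 1 v) (hn' : τ'.length + 2 * e' + 1 = binVal 1 v') :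
    e = e' ∧ ρ = ρ' ∧ τ = τ' := by
  obtain ⟨rfl, hp⟩ := OptimalMachine.split_prefix h
  have h1 : v ∈ U ρ := (hu _ _).2 ⟨s, hv⟩
  have h2 : v' ∈ U ρ' := (hu _ _).2 ⟨s', hv'⟩
  have d1 := Part.dom_iff_mem.2 ⟨v, h1⟩
  have d2 := Part.dom_iff_mem.2 ⟨v', h2⟩
  have hρ : ρ = ρ' := by
    rcases List.prefix_or_prefix_of_prefix ((List.prefix_append ρ τ).trans hp)
      (List.prefix_append ρ' τ') with H | H
    · exact hpf _ _ d1 d2 H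
    · exact (hpf _ _ d2 d1 H).symm
  subst hρ
  obtain rfl := Part.mem_unique h1 h2
  exact ⟨rfl, rfl, ((List.prefix_append_right_inj ρ).1 hp).eq_of_length (by omega)⟩

theorem isPrefixFreeMachine_blockMachine (hU : IsPrefixFreeMachine U) (hu' : Primrec₂ u)
    (hu : ∀ σ x, x ∈ U σ ↔ ∃ s, u σ s = some x) (hw : Primrec₂ w) :
    IsPrefixFreeMachine (blockMachine u w) := by
  refine ⟨Partrec.rfindOpt (primrec_blockStep hu' hw).to_comp, fun σ σ' h h' hp => ?_⟩
  obtain ⟨p, x, hx⟩ := Nat.rfindOpt_dom.1 h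
  obtain ⟨p', x', hx'⟩ := Nat.rfindOpt_dom.1 h'
  obtain ⟨e, ρ, τ, v, s, T, rfl, hv, hn, -⟩ := exists_blockStep_eq_some.1 ⟨p, hx⟩
  obtain ⟨e', ρ', τ', v', s', T', rfl, hv', hn', -⟩ := exists_blockStep_eq_some.1 ⟨p', hx'⟩
  obtain ⟨rfl, rfl, rfl⟩ := parse_unique hU.2 hu hp hv hv' hn hn'
  rfl

/-- `Nat.rfindOpt` returns only the first hit, but all hits agree: the parse is unique and indices
are stable over stages. -/
theorem mem_blockMachine (hU : IsPrefixFreeMachine U) (hu : ∀ σ x, x ∈ U σ ↔ ∃ s, u σ s = some x)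
    {α x : List Bool} (h : ∃ p, blockStep u w α p = some x) : x ∈ blockMachine u w α := by
  obtain ⟨y, hy⟩ := Part.dom_iff_mem.1 (Nat.rfindOpt_dom.2 (h.imp fun p hp => ⟨x, hp⟩) :
    (blockMachine u w α).Dom)
  obtain ⟨e, ρ, τ, v, s, T, rfl, hv, hn, hx⟩ := exists_blockStep_eq_some.1 h
  obtain ⟨e', ρ', τ', v', s', T', heq, hv', hn', hx'⟩ :=
    exists_blockStep_eq_some.1 (Nat.rfindOpt_spec hy)
  obtain ⟨rfl, rfl, rfl⟩ :=
    parse_unique hU.2 hu (heq ▸ List.prefix_rfl) hv hv' hn hn'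
  exact collect_getElem?_unique hx hx' ▸ hy

end blockMachine

/-! ### Complexity of strings -/

theorem prefixK_le {U : List Bool →. List Bool} {x σ : List Bool} (h : x ∈ U σ) :
    prefixK U x ≤ σ.length := Nat.sInf_le ⟨σ, h, rfl⟩

theorem isPrefixFreeMachine_single (x : List Bool) :
    IsPrefixFreeMachine fun σ => ((if σ = [] then some x else none : Option (List Bool)) : Part _) := by
  refine ⟨Computable.ofOption (Primrec.to_comp (Primrec.ite
    (Primrec.eq.comp Primrec.id (Primrec.const [])) (Primrec.const _) (Primrec.const _))), ?_⟩
  intro σ τ hσ hτ _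
  have key : ∀ σ : List Bool,
      ((if σ = [] then some x else none : Option (List Bool)) : Part (List Bool)).Dom → σ = [] := by
    intro σ hσ
    by_contra hne
    simp [hne] at hσ
  rw [key σ hσ, key τ hτ]

/-- Simulating the machine that maps the empty string to `x` shows that `x` has a description, so
`sInf` is attained and is not the default value of the empty set. -/
theorem IsOptimalPrefixFreeMachine.exists_length_eq_prefixK {U : List Bool →. List Bool}
    (hU : IsOptimalPrefixFreeMachine U) (x : List Bool) :
    ∃ σ, x ∈ U σ ∧ σ.length = prefixK U x := by
  obtain ⟨c, hc⟩ := hU.2 _ (isPrefixFreeMachine_single x)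
  obtain ⟨τ, hτ, -⟩ := hc [] x (by simp)
  exact Nat.sInf_mem (s := {l : ℕ | ∃ σ : List Bool, x ∈ U σ ∧ σ.length = l}) ⟨_, τ, hτ, rfl⟩

/-- The set of strings of length `n` with a prefix in the section `W m`, or all of them if
`m = 0`. -/
def blockSet (W : ℕ × List Bool → Prop) (m n : ℕ) : Set (List Bool) :=
  {x | x.length = n ∧ (m = 0 ∨ ∃ j, W (m, x.take j))}

/-- The description `0^k 1 ρ τ` has length `k + 1 + K(n) + (n - 2k)`. One machine serves all `k` and
`n`, since both are read off the input; this makes `c` uniform. -/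
theorem exists_prefixK_add_le {U : List Bool →. List Bool} (hU : IsOptimalPrefixFreeMachine U)
    {W : ℕ × List Bool → Prop} (hW : REPred W)
    (hcard : ∀ m n (F : Finset (List Bool)), ↑F ⊆ blockSet W m n → F.card * 2 ^ m ≤ 2 ^ n) :
    ∃ c, ∀ k n, ∀ x ∈ blockSet W (2 * k) n, prefixK U x + k ≤ n + prefixKNat U n + c := by
  obtain ⟨u, hu', hu⟩ := Partrec.exists_primrec_approx hU.1.1
  obtain ⟨w, hw', hw⟩ := hW.exists_primrec_approx
  obtain ⟨c, hc⟩ := hU.2 _ (isPrefixFreeMachine_blockMachine hU.1 hu' hu hw')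
  refine ⟨c + 1, fun k n x hx => ?_⟩
  have hiff : ∀ y, y ∈ blockSet W (2 * k) n ↔ ∃ t, candidate w (2 * k, n) t = some y := by
    intro y
    simp only [exists_candidate_eq_some, blockSet, Set.mem_ofPred_eq, hw]
  obtain ⟨t, ht⟩ := (hiff x).1 hx
  have hmem : x ∈ collect (candidate w (2 * k, n)) (t + 1) := mem_collect.2 ⟨t, t.lt_succ_self, ht⟩
  obtain ⟨i, hi, hix⟩ := List.getElem_of_mem hmem
  -- The finite stage at which `x` has appeared suffices: its list already obeys the bound
  -- `2^{n-2k}`, so the index of `x` fits into `n - 2k` bits.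
  have hF := hcard (2 * k) n (collect (candidate w (2 * k, n)) (t + 1)).toFinset (by
    intro y hy
    rw [Finset.mem_coe, List.mem_toFinset, mem_collect] at hy
    exact (hiff y).2 (hy.imp fun _ h => h.2))
  rw [List.toFinset_card_of_nodup (nodup_collect _ _)] at hF
  have hkn : 2 * k ≤ n := (Nat.pow_le_pow_iff_right (a := 2) (by norm_num)).1
    ((Nat.le_mul_of_pos_left _ (by omega)).trans hF)
  have hi2 : i < 2 ^ (n - 2 * k) := by
    refine hi.trans_le (Nat.le_of_mul_le_mul_right (c := 2 ^ (2 * k)) ?_ (by positivity))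
    rwa [← pow_add, Nat.sub_add_cancel hkn]
  obtain ⟨τ, hτl, hτ⟩ := exists_binVal_zero_eq _ i hi2
  have hτn : τ.length + 2 * k = n := by omega
  obtain ⟨ρ, hρ, hρl⟩ := hU.exists_length_eq_prefixK (natToString n)
  obtain ⟨s, hs⟩ := (hu _ _).1 hρ
  obtain ⟨σ, hσ, hσl⟩ := hc (List.replicate k false ++ true :: (ρ ++ τ)) x
    (mem_blockMachine hU.1 hu (exists_blockStep_eq_some.2
      ⟨k, ρ, τ, _, s, t + 1, rfl, hs, by rw [binVal_natToString, hτn], by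
        rw [hτn, hτ, List.getElem?_eq_getElem hi, hix]⟩))
  have := prefixK_le hσ
  simp only [List.length_append, List.length_replicate, List.length_cons, hρl] at hσl
  rw [prefixKNat]
  omega

/-! ### Cylinders and initial segments -/

/-- The initial segment of length `n` of a sequence. -/
def initialSegment (n : ℕ) (Z : ℕ → Bool) : List Bool := List.ofFn fun i : Fin n => Z i

theorem mem_stringCylinder_iff {σ : List Bool} {Z : ℕ → Bool} :
    Z ∈ stringCylinder σ ↔ initialSegment σ.length Z = σ := by
  constructor
  · intro h
    refine List.ext_getElem (by simp [initialSegment]) fun i _ hi => ?_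
    simpa [initialSegment] using h i hi
  · intro h i hi
    have h1 : i < (initialSegment σ.length Z).length := by simpa [initialSegment] using hi
    have h2 : (initialSegment σ.length Z)[i] = Z i := by simp [initialSegment]
    rw [← h2]
    exact List.getElem_of_eq h h1

theorem initialSegment_take {n j : ℕ} (h : j ≤ n) (Z : ℕ → Bool) :
    (initialSegment n Z).take j = initialSegment j Z :=
  List.ext_getElem (by simp [initialSegment, h]) fun i _ _ => by simp [initialSegment]

theorem stringCylinder_ofFn {n : ℕ} (x : Fin n → Bool) :
    stringCylinder (List.ofFn x) = (fun (Z : ℕ → Bool) (i : Fin n) => Z i) ⁻¹' {x} := by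
  ext Z
  have h : (List.ofFn x).length = n := by simp
  rw [mem_stringCylinder_iff, h]
  simp [initialSegment, List.ofFn_inj]

theorem measurableSet_stringCylinder (σ : List Bool) : MeasurableSet (stringCylinder σ) := by
  obtain ⟨n, x, rfl⟩ : ∃ n, ∃ x : Fin n → Bool, List.ofFn x = σ :=
    ⟨_, σ.get, List.ofFn_get σ⟩
  rw [stringCylinder_ofFn]
  exact (measurable_pi_lambda _ fun i => measurable_pi_apply _) (measurableSet_singleton x)

theorem uniformMeasure_stringCylinder (σ : List Bool) :
    uniformMeasure (stringCylinder σ) = (2 ^ σ.length : ENNReal)⁻¹ := by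
  have h : stringCylinder σ =
      Set.pi (Finset.range σ.length : Set ℕ) fun i => {σ.getD i false} := by
    ext Z
    simp only [stringCylinder, Set.mem_ofPred_eq, Set.mem_pi, Finset.coe_range, Set.mem_Iio,
      Set.mem_singleton_iff]
    exact forall₂_congr fun i hi => by rw [List.getD_eq_getElem _ _ hi]
  rw [h, uniformMeasure, Measure.infinitePi_pi _ fun i _ => measurableSet_singleton _]
  simp [ENNReal.inv_pow]

instance isProbabilityMeasure_uniformMeasure : IsProbabilityMeasure uniformMeasure := by
  unfold uniformMeasure
  infer_instance

/-- This form makes it visible that, for `m ≠ 0`, the event grows with `n` and exhausts the open set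
of section `m`. -/
theorem initialSegment_mem_blockSet {W : ℕ × List Bool → Prop} {m n : ℕ} {Z : ℕ → Bool} :
    initialSegment n Z ∈ blockSet W m n ↔
      m = 0 ∨ ∃ σ, W (m, σ) ∧ σ.length ≤ n ∧ Z ∈ stringCylinder σ := by
  have hl : (initialSegment n Z).length = n := by simp [initialSegment]
  simp only [blockSet, Set.mem_ofPred_eq, hl, true_and]
  refine or_congr_right ⟨?_, ?_⟩
  · rintro ⟨j, hj⟩
    -- For `j > n`, `take` returns the whole segment, hence the minimum.
    have hmin : (initialSegment n Z).take j = initialSegment (min j n) Z := by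
      rw [← initialSegment_take (min_le_right j n), ← List.take_take, List.take_of_length_le hl.le]
    have hlen : ∀ k, (initialSegment k Z).length = k := fun k => by simp [initialSegment]
    refine ⟨_, hj, ?_, ?_⟩
    · rw [hmin, hlen]; exact min_le_right j n
    · rw [mem_stringCylinder_iff, hmin, hlen]
  · rintro ⟨σ, hσ, hn, hZ⟩
    refine ⟨σ.length, ?_⟩
    rwa [initialSegment_take hn, mem_stringCylinder_iff.1 hZ]

/-- The cylinders of distinct strings of length `n` are disjoint, of measure `2^{-n}` each. They lie
in an open set of measure at most `2^{-m}`, or in the whole space if `m = 0`. -/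
theorem card_mul_two_pow_le {W : ℕ × List Bool → Prop}
    (hW : ∀ m, uniformMeasure (⋃ σ ∈ {σ | W (m, σ)}, stringCylinder σ) ≤ (2 ^ m : ENNReal)⁻¹)
    (m n : ℕ) (F : Finset (List Bool)) (hF : ↑F ⊆ blockSet W m n) : F.card * 2 ^ m ≤ 2 ^ n := by
  have hlen : ∀ x ∈ F, x.length = n := fun x hx => (hF hx).1
  have hdisj : (F : Set (List Bool)).PairwiseDisjoint stringCylinder := by
    intro x hx y hy hxy
    refine Set.disjoint_left.2 fun Z hZ hZ' => hxy ?_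
    rw [mem_stringCylinder_iff, hlen x hx] at hZ
    rw [mem_stringCylinder_iff, hlen y hy] at hZ'
    exact hZ.symm.trans hZ'
  have h1 : uniformMeasure (⋃ x ∈ F, stringCylinder x) = F.card * (2 ^ n : ENNReal)⁻¹ := by
    rw [measure_biUnion_finset hdisj fun x _ => measurableSet_stringCylinder x,
      Finset.sum_congr rfl fun x hx => by rw [uniformMeasure_stringCylinder, hlen x hx]]
    simp
  have h2 : uniformMeasure (⋃ x ∈ F, stringCylinder x) ≤ (2 ^ m : ENNReal)⁻¹ := by
    rcases eq_or_ne m 0 with rfl | hm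
    · simpa using prob_le_one
    · refine (measure_mono (Set.iUnion₂_subset fun x hx Z hZ => ?_)).trans (hW m)
      have hmem := hF hx
      rw [mem_stringCylinder_iff, hlen x hx] at hZ
      rw [← hZ, initialSegment_mem_blockSet] at hmem
      obtain ⟨σ, hσ, -, hZσ⟩ := hmem.resolve_left hm
      exact Set.mem_biUnion hσ hZσ
  rw [h1, ← div_eq_mul_inv, ENNReal.div_le_iff (by positivity) (by finiteness), mul_comm,
    ← div_eq_mul_inv, ENNReal.le_div_iff_mul_le (by simp) (by simp)] at h2
  exact_mod_cast h2

/-! ### The average complexity -/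

/-- The pointwise bounds are averaged over the strings of length `n`; those in the block save `k`
each. -/
theorem averageK_add_le {U : List Bool →. List Bool} {W : ℕ × List Bool → Prop} {c k n : ℕ}
    (h0 : ∀ x ∈ blockSet W 0 n, prefixK U x ≤ n + prefixKNat U n + c)
    (hk : ∀ x ∈ blockSet W (2 * k) n, prefixK U x + k ≤ n + prefixKNat U n + c)
    (μ : Measure (ℕ → Bool)) [IsProbabilityMeasure μ] :
    averageK U μ n + k * μ.real {Z | initialSegment n Z ∈ blockSet W (2 * k) n} ≤
      n + prefixKNat U n + c := by
  classical
  set f : (ℕ → Bool) → Fin n → Bool := fun Z i => Z i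
  have hf : Measurable f := measurable_pi_lambda _ fun i => measurable_pi_apply _
  have hsum : ∀ s : Finset (Fin n → Bool), ∑ x ∈ s, μ.real (f ⁻¹' {x}) = μ.real (f ⁻¹' s) :=
    fun s => sum_measureReal_preimage_singleton s fun x _ => hf (measurableSet_singleton x)
  have hS : {Z | initialSegment n Z ∈ blockSet W (2 * k) n} =
      f ⁻¹' (Finset.univ.filter fun x : Fin n → Bool => List.ofFn x ∈ blockSet W (2 * k) n) := by
    ext Z
    simp [initialSegment, f]
  -- Total mass one turns the right-hand side into a sum over strings, so that the comparison is
  -- termwise.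
  have hone : ∑ x, μ.real (f ⁻¹' {x}) = 1 := by rw [hsum]; simp
  rw [averageK, hS, ← hsum, Finset.mul_sum, Finset.sum_filter, ← Finset.sum_add_distrib,
    ← mul_one ((n : ℝ) + prefixKNat U n + c), ← hone, Finset.mul_sum]
  refine Finset.sum_le_sum fun x _ => ?_
  rw [stringCylinder_ofFn]
  split_ifs with hx
  · rw [← add_mul]
    exact mul_le_mul_of_nonneg_right (by exact_mod_cast hk _ hx) measureReal_nonneg
  · rw [add_zero]
    exact mul_le_mul_of_nonneg_right (by exact_mod_cast h0 _ ⟨by simp, Or.inl rfl⟩)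
      measureReal_nonneg

theorem mainTheorem10 (U : List Bool →. List Bool) (hU : IsOptimalPrefixFreeMachine U)
    (μ : Measure (ℕ → Bool)) [IsProbabilityMeasure μ] (r : ℝ)
    (hμ : {n : ℕ | (n : ℝ) + (prefixKNat U n : ℝ) - r ≤ averageK U μ n}.Infinite) :
    IsMLAbsolutelyContinuous μ := by
  rintro G ⟨⟨W, hW, hG⟩, hlam⟩
  by_contra hne
  obtain ⟨c, hc⟩ := exists_prefixK_add_le hU hW
    (card_mul_two_pow_le fun m => by rw [← hG]; exact hlam m)
  obtain ⟨δ, hδ0, hδ⟩ := ENNReal.lt_iff_exists_nnreal_btwn.1 (pos_iff_ne_zero.2 hne)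
  have hδ' : (0 : ℝ) < δ := by exact_mod_cast hδ0
  -- The saving `kδ` must exceed the slack `r + c`. The maximum with `0` forces `k ≠ 0`, so that
  -- block `2k` comes from the test and is not the block of all strings.
  obtain ⟨k, hk⟩ := exists_nat_gt (max 0 ((r + c) / δ))
  have hk0 : k ≠ 0 := by
    rintro rfl
    simp at hk
  have hkδ : r + c < k * δ := (div_lt_iff₀ hδ').1 ((le_max_right _ _).trans_lt hk)
  set D : ℕ → Set (ℕ → Bool) := fun n => {Z | initialSegment n Z ∈ blockSet W (2 * k) n}
  have hmemD : ∀ n Z, Z ∈ D n ↔ ∃ σ, W (2 * k, σ) ∧ σ.length ≤ n ∧ Z ∈ stringCylinder σ :=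
    fun n Z => initialSegment_mem_blockSet.trans (or_iff_right (by omega))
  have hmono : Monotone D := by
    intro a b hab Z hZ
    obtain ⟨σ, h1, h2, h3⟩ := (hmemD a Z).1 hZ
    exact (hmemD b Z).2 ⟨σ, h1, h2.trans hab, h3⟩
  have hGD : G (2 * k) ⊆ ⋃ n, D n := by
    rw [hG]
    exact Set.iUnion₂_subset fun σ hσ Z hZ =>
      Set.mem_iUnion.2 ⟨σ.length, (hmemD _ Z).2 ⟨σ, hσ, le_rfl, hZ⟩⟩
  have hδD : (δ : ENNReal) < μ (⋃ n, D n) :=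
    hδ.trans_le ((iInf_le _ (2 * k)).trans (measure_mono hGD))
  -- Continuity from below gives `μ (D n) > δ` for all large `n`, so infinitely many `n` in the
  -- hypothesis are enough.
  have hev := (tendsto_measure_iUnion_atTop (μ := μ) hmono).eventually_const_lt hδD
  obtain ⟨N, hN⟩ := Filter.eventually_atTop.1 hev
  obtain ⟨n, hn, hNn⟩ := hμ.exists_gt N
  have hreal : (δ : ℝ) ≤ μ.real (D n) :=
    (ENNReal.ofReal_le_iff_le_toReal (measure_ne_top μ _)).1 (by simpa using (hN n hNn.le).le)
  have hav := averageK_add_le (fun x hx => by simpa using hc 0 n x hx) (hc k n) μ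
  have hmul : (k : ℝ) * δ ≤ k * μ.real (D n) := mul_le_mul_of_nonneg_left hreal k.cast_nonneg
  have hn' : (n : ℝ) + (prefixKNat U n : ℝ) - r ≤ averageK U μ n := hn
  linarith
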